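/- Let $\Gamma$ be a finite simple graph with vertex set $X$, and let $G=G(\Gamma)$ be the partially commutative group with generating set $X$ and a defining relation $x^{-1}y^{-1}xy=1$ for every edge $\{x,y\}$ of $\Gamma$. For $Y\subseteq X$ let $G(Y)$ be the subgroup of $G$ generated by $Y$, let $Y^\perp$ be the set of all $u\in X$ with $d(u,y)\le 1$ for all $y\in Y$ (so $\emptyset^\perp=X$), and let $\operatorname{cl}(Y)=Y^{\perp\perp}$. Let $L$ be the set of closed subsets of $X$, that is, those $Y\subseteq X$ with $Y=\operatorname{cl}(Y)$. Write $\operatorname{cl}(x)=\operatorname{cl}(\{x\})$ for $x\in X$; call $x$ $L$-maximal if $\operatorname{cl}(x)\subseteq\operatorname{cl}(y)$ implies $\operatorname{cl}(y)=\operatorname{cl}(x)$, for all $y\in X$; and let $L^{\max}$ be the set of all $\operatorname{cl}(x)$ with $x$ an $L$-maximal vertex. For $\mathcal S=L$ or $\mathcal S=L^{\max}$ let $$\operatorname{St}(\mathcal S)=\{\varphi\in\operatorname{Aut}(G) : \varphi(G(Y))=G(Y)\text{ for all }Y\in\mathcal S\}.$$ Then $\operatorname{St}(L)$ and $\operatorname{St}(L^{\max})$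 are commensurable, that is, their intersection has finite index in each of them. In fact $\operatorname{St}(L)\le\operatorname{St}(L^{\max})$, and this subgroup has finite index. More precisely, let $M$ be the finite set of all $Y\in L$ that are contained in some $Z\in L^{\max}$. Then there is a homomorphism $\sigma$ from $\operatorname{St}(L^{\max})$ to the group of permutations of $M$ such that, for all $\varphi\in\operatorname{St}(L^{\max})$ and $Y,V\in M$, one has $\sigma(\varphi)(Y)=V$ if and only if $\varphi(G(Y))=G(V)$. Moreover, if $Y\subseteq Z\in L^{\max}$ then $\sigma(\varphi)(Y)\subseteq Z$; and $\ker\sigma\subseteq\operatorname{St}(L)$. -/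

import Mathlib

/-!  Partially commutative groups, closed sets of vertices, and stabilisers of
families of canonical parabolic subgroups. -/

namespace PCGroup

variable {X : Type*} (Γ : SimpleGraph X)

/-- The orthogonal complement `Y^⊥` : the vertices at distance at most one from every vertex
of `Y`. The distance is extended, so vertices in different components are at distance `⊤`. -/
def orth (Y : Set X) : Set X :=
  {u | ∀ y ∈ Y, Γ.edist u y ≤ 1}

theorem mem_orth_iff {Y : Set X} {u : X} :
    u ∈ orth Γ Y ↔ ∀ y ∈ Y, Γ.Adj u y ∨ u = y := by
  simp only [orth, Set.mem_ofPred_eq, SimpleGraph.edist_le_one_iff_adj_or_eq]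

/-- The closure `cl(Y) = Y^⊥⊥`. -/
def cl (Y : Set X) : Set X :=
  orth Γ (orth Γ Y)

/-- The set `L(Γ)` of closed subsets of the vertex set. -/
def closedSets : Set (Set X) :=
  {Y | Y = cl Γ Y}

/-- A vertex `x` is `L`-maximal if `cl(x) ⊆ cl(y)` implies `cl(y) = cl(x)`. -/
def IsLMaximal (x : X) : Prop :=
  ∀ y : X, cl Γ {x} ⊆ cl Γ {y} → cl Γ {y} = cl Γ {x}

/-- The set `L^max` of closures of `L`-maximal vertices. -/
def maxClosures : Set (Set X) :=
  {Y | ∃ x : X, IsLMaximal Γ x ∧ Y = cl Γ {x}}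

/-- The closed sets that are contained in some member of `L^max`. -/
def closedBelowMax : Set (Set X) :=
  {Y | Y ∈ closedSets Γ ∧ ∃ Z ∈ maxClosures Γ, Y ⊆ Z}

/-- The defining relators `[x, y] = x⁻¹ y⁻¹ x y`, one for every ordered pair of adjacent
vertices. -/
def relators : Set (FreeGroup X) :=
  {r | ∃ x y : X, Γ.Adj x y ∧
    r = (FreeGroup.of x)⁻¹ * (FreeGroup.of y)⁻¹ * FreeGroup.of x * FreeGroup.of y}

/-- The partially commutative group `G(Γ)`. -/
abbrev Grp : Type _ :=
  PresentedGroup (relators Γ)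

/-- The canonical parabolic subgroup `G(Y)`, generated by `Y`. -/
def parabolic (Y : Set X) : Subgroup (Grp Γ) :=
  Subgroup.closure ((fun x : X => (PresentedGroup.of x : Grp Γ)) '' Y)

/-- The group of automorphisms `φ` of `G(Γ)` such that `φ(G(Y)) = G(Y)` for all `Y` in the
family `S`. -/
def stabiliser (S : Set (Set X)) : Subgroup (MulAut (Grp Γ)) where
  carrier := {φ | ∀ Y ∈ S, (parabolic Γ Y).map φ.toMonoidHom = parabolic Γ Y}
  one_mem' := fun Y _ => Subgroup.map_id _
  mul_mem' := by
    intro φ ψ hφ hψ Y hY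
    have h : (φ * ψ).toMonoidHom = φ.toMonoidHom.comp ψ.toMonoidHom := rfl
    rw [h, ← Subgroup.map_map, hψ Y hY, hφ Y hY]
  inv_mem' := by
    intro φ hφ Y hY
    have h : (φ⁻¹).toMonoidHom.comp φ.toMonoidHom = MonoidHom.id (Grp Γ) := by
      refine MonoidHom.ext fun g => ?_
      exact MulEquiv.symm_apply_apply φ g
    conv_lhs => rw [← hφ Y hY]
    rw [Subgroup.map_map, h, Subgroup.map_id]

/-- `St(L)`. -/
def St : Subgroup (MulAut (Grp Γ)) :=
  stabiliser Γ (closedSets Γ)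

/-- `St(L^max)`. -/
def StMax : Subgroup (MulAut (Grp Γ)) :=
  stabiliser Γ (maxClosures Γ)

end PCGroup

/-!
The argument rests on one fact about centralisers. Fix a vertex `z` and let `n_z : G → ℤ` be the
exponent sum of `z`. The group `G` acts on `G/G(z^⊥) × ℤ`: a vertex other than `z` acts by left
translation of the coset, while `z` moreover raises the integer by one at the trivial coset. The
relations hold because every vertex of `z^⊥` fixes the trivial coset. An element `h` of `G(z^⊥)`
changes the integer by `n_z(h)` at the trivial coset and nowhere else, so if `g` commutes with `h`
and `n_z(h) ≠ 0`, then `g` fixes the trivial coset, that is, `g ∈ G(z^⊥)`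
(`mem_parabolic_orth_of_commute`).

The closure of a vertex is a clique, so for `Z ∈ L^max` the group `G(Z)` is abelian. If `H ≤ G(Z)`
has support `S` (the vertices `z` with `n_z(h) ≠ 0` for some `h ∈ H`), then the fact above gives
`C(H) = G(S^⊥)`, and hence `C(C(H)) = G(cl(S))`
(`centralizer_centralizer_of_le_parabolic`). For a closed set `Y` we have `C(C(G(Y))) = G(Y)`.
Automorphisms respect double centralisers, so if `φ ∈ St(L^max)` and `Y ⊆ Z` is closed, then
`φ(G(Y)) ≤ G(Z)` is its own double centraliser and therefore equals `G(V)` for a closed `V ⊆ Z`.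
This gives an action of `St(L^max)` on the finite set of closed sets below `L^max`. Every closed
set is a union of closures of vertices, each of which lies below `L^max`, so the kernel of the
action lies in `St(L)`.
-/

namespace PCGroup

/-! ### Orthogonal complements and closures -/

section Orth

variable {X : Type*} (Γ : SimpleGraph X)

theorem orth_anti {Y Z : Set X} (h : Y ⊆ Z) : orth Γ Z ⊆ orth Γ Y :=
  fun _ hu y hy => hu y (h hy)

theorem subset_orth_comm {Y Z : Set X} (h : Y ⊆ orth Γ Z) : Z ⊆ orth Γ Y :=
  fun z hz y hy => by rw [SimpleGraph.edist_comm]; exact h hy z hz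

theorem subset_cl (Y : Set X) : Y ⊆ cl Γ Y :=
  subset_orth_comm Γ subset_rfl

theorem cl_mono {Y Z : Set X} (h : Y ⊆ Z) : cl Γ Y ⊆ cl Γ Z :=
  orth_anti Γ (orth_anti Γ h)

theorem cl_orth (Y : Set X) : cl Γ (orth Γ Y) = orth Γ Y :=
  (orth_anti Γ (subset_cl Γ Y)).antisymm (subset_cl Γ _)

theorem cl_mem_closedSets (Y : Set X) : cl Γ Y ∈ closedSets Γ :=
  (cl_orth Γ (orth Γ Y)).symm

theorem cl_subset_of_closed {Y Z : Set X} (hZ : Z ∈ closedSets Γ) (h : Y ⊆ Z) : cl Γ Y ⊆ Z :=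
  (cl_mono Γ h).trans (Eq.symm hZ).subset

theorem self_mem_orth (x : X) : x ∈ orth Γ {x} := by
  simp [mem_orth_iff]

theorem orth_eq_iInter (S : Set X) : orth Γ S = ⋂ z ∈ S, orth Γ {z} := by
  ext u; simp [mem_orth_iff]

/-- The closure of a vertex is a clique: since `x ∈ x^⊥`, it is contained in `x^⊥`, hence in its
own orthogonal complement. -/
theorem cl_singleton_subset_orth (x : X) : cl Γ {x} ⊆ orth Γ (cl Γ {x}) := by
  have h : cl Γ {x} ⊆ orth Γ {x} :=
    orth_anti Γ (Set.singleton_subset_iff.2 (self_mem_orth Γ x))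
  exact h.trans (cl_orth Γ {x}).symm.subset

theorem maxClosures_subset_closedSets : maxClosures Γ ⊆ closedSets Γ := by
  rintro _ ⟨x, -, rfl⟩
  exact cl_mem_closedSets Γ _

/-- Since there are finitely many vertices, every closure of a vertex lies below a maximal one. -/
theorem cl_singleton_mem_closedBelowMax [Finite X] (y : X) :
    cl Γ {y} ∈ closedBelowMax Γ := by
  obtain ⟨z, hz, hmax⟩ := Set.Finite.exists_maximalFor (fun z : X => cl Γ {z})
    {z | cl Γ {y} ⊆ cl Γ {z}} (Set.toFinite _) ⟨y, subset_refl (cl Γ {y})⟩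
  exact ⟨cl_mem_closedSets Γ _, cl Γ {z},
    ⟨z, fun w hw => (hmax (subset_trans hz hw) hw).antisymm hw, rfl⟩, hz⟩

end Orth

/-! ### Canonical parabolic subgroups -/

section Parabolic

variable {X : Type*} (Γ : SimpleGraph X)

theorem of_mem_parabolic {A : Set X} {x : X} (hx : x ∈ A) :
    (PresentedGroup.of x : Grp Γ) ∈ parabolic Γ A :=
  Subgroup.subset_closure ⟨x, hx, rfl⟩

theorem parabolic_le_iff {A : Set X} {H : Subgroup (Grp Γ)} :
    parabolic Γ A ≤ H ↔ ∀ x ∈ A, (PresentedGroup.of x : Grp Γ) ∈ H := by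
  simp [parabolic, Subgroup.closure_le, Set.subset_def]

theorem parabolic_mono {A B : Set X} (h : A ⊆ B) : parabolic Γ A ≤ parabolic Γ B :=
  (parabolic_le_iff Γ).2 fun _ hx => of_mem_parabolic Γ (h hx)

theorem commute_of_adj {x y : X} (h : Γ.Adj x y) :
    Commute (PresentedGroup.of x : Grp Γ) (PresentedGroup.of y) := by
  have := PresentedGroup.one_of_mem (rels := relators Γ) ⟨x, y, h, rfl⟩
  simp only [map_mul, map_inv] at this
  change (PresentedGroup.of x : Grp Γ)⁻¹ * (PresentedGroup.of y)⁻¹ * PresentedGroup.of x *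
    PresentedGroup.of y = 1 at this
  change (PresentedGroup.of x : Grp Γ) * PresentedGroup.of y = _
  rw [mul_assoc, ← mul_inv_rev, inv_mul_eq_one] at this
  exact this.symm

/-- The homomorphism out of `G(Γ)` given by a map on vertices that sends adjacent vertices to
commuting elements. -/
noncomputable def liftHom {H : Type*} [Group H] (f : X → H)
    (hf : ∀ x y, Γ.Adj x y → Commute (f x) (f y)) : Grp Γ →* H :=
  PresentedGroup.toGroup (f := f) (by
    rintro _ ⟨x, y, hxy, rfl⟩
    simp only [map_mul, map_inv, FreeGroup.lift_apply_of]
    rw [mul_assoc, ← mul_inv_rev, inv_mul_eq_one]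
    exact (hf x y hxy).symm.eq)

@[simp]
theorem liftHom_of {H : Type*} [Group H] (f : X → H)
    (hf : ∀ x y, Γ.Adj x y → Commute (f x) (f y)) (x : X) :
    liftHom Γ f hf (PresentedGroup.of x) = f x :=
  PresentedGroup.toGroup.of _

theorem parabolic_le_centralizer_iff {A B : Set X} :
    parabolic Γ A ≤ Subgroup.centralizer (parabolic Γ B : Set (Grp Γ)) ↔
      ∀ x ∈ A, ∀ y ∈ B,
        Commute (PresentedGroup.of y : Grp Γ) (PresentedGroup.of x) := by
  rw [parabolic_le_iff, parabolic, Subgroup.centralizer_closure]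
  simp only [Subgroup.mem_centralizer_iff, Set.forall_mem_image]
  rfl

theorem parabolic_orth_le_centralizer (A : Set X) :
    parabolic Γ (orth Γ A) ≤ Subgroup.centralizer (parabolic Γ A : Set (Grp Γ)) := by
  rw [parabolic_le_centralizer_iff]
  intro x hx y hy
  rcases (mem_orth_iff Γ).1 hx y hy with h | rfl
  · exact (commute_of_adj Γ h).symm
  · exact Commute.refl _

open Classical in
/-- The map on vertices that agrees with `f` on `A` and is `1` elsewhere. -/
noncomputable def keep {H : Type*} [Group H] (A : Set X) (f : X → H) (x : X) : H :=
  if x ∈ A then f x else 1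

/-- The retraction of `G` onto `G(A)` that kills the vertices outside `A`. -/
noncomputable def retract (A : Set X) : Grp Γ →* Grp Γ :=
  liftHom Γ (keep A PresentedGroup.of) (by
    intro x y h
    unfold keep
    split_ifs
    · exact commute_of_adj Γ h
    · exact Commute.one_right _
    · exact Commute.one_left _
    · exact Commute.one_left _)

theorem mem_parabolic_iff_retract {A : Set X} {g : Grp Γ} :
    g ∈ parabolic Γ A ↔ retract Γ A g = g := by
  constructor
  · intro hg
    have : parabolic Γ A ≤ (retract Γ A).eqLocus (MonoidHom.id _) :=
      (parabolic_le_iff Γ).2 fun x hx => by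
        change retract Γ A (PresentedGroup.of x) = PresentedGroup.of x
        simp [retract, keep, hx]
    exact this hg
  · intro hg
    rw [← hg]
    have : ⊤ ≤ (parabolic Γ A).comap (retract Γ A) := by
      rw [← PresentedGroup.closure_range_of (relators Γ), Subgroup.closure_le]
      rintro _ ⟨x, rfl⟩
      by_cases hx : x ∈ A
      · simpa [retract, keep, hx] using of_mem_parabolic Γ hx
      · simp [retract, keep, hx]
    exact this (Subgroup.mem_top g)

theorem retract_retract (A B : Set X) (g : Grp Γ) :
    retract Γ A (retract Γ B g) = retract Γ (A ∩ B) g := by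
  have : (retract Γ A).comp (retract Γ B) = retract Γ (A ∩ B) := by
    refine PresentedGroup.ext fun x => ?_
    by_cases hA : x ∈ A <;> by_cases hB : x ∈ B <;> simp [retract, keep, hA, hB]
  exact DFunLike.congr_fun this g

theorem mem_parabolic_inter {A B : Set X} {g : Grp Γ} (hA : g ∈ parabolic Γ A)
    (hB : g ∈ parabolic Γ B) : g ∈ parabolic Γ (A ∩ B) := by
  rw [mem_parabolic_iff_retract] at *
  rw [← retract_retract, hB, hA]

theorem mem_parabolic_univ (g : Grp Γ) : g ∈ parabolic Γ Set.univ := by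
  rw [parabolic, Set.image_univ, PresentedGroup.closure_range_of]
  exact Subgroup.mem_top g

theorem mem_parabolic_biInter {ι : Type*} {S : Set ι} (hS : S.Finite) (f : ι → Set X)
    {g : Grp Γ} (h : ∀ i ∈ S, g ∈ parabolic Γ (f i)) : g ∈ parabolic Γ (⋂ i ∈ S, f i) := by
  induction S, hS using Set.Finite.induction_on with
  | empty => simpa using mem_parabolic_univ Γ g
  | insert _ _ ih =>
    rw [Set.biInter_insert]
    exact mem_parabolic_inter Γ (h _ (Set.mem_insert _ _))
      (ih fun i hi => h i (Set.mem_insert_of_mem _ hi))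

end Parabolic

/-! ### Exponent sums -/

section Expo

variable {X : Type*} (Γ : SimpleGraph X)

/-- The exponent sum of the vertex `z`, as a homomorphism to the infinite cyclic group. -/
noncomputable def expo (z : X) : Grp Γ →* Multiplicative ℤ :=
  liftHom Γ (keep {z} fun _ => Multiplicative.ofAdd 1) fun _ _ _ => Commute.all _ _

theorem expo_of_self (z : X) : expo Γ z (PresentedGroup.of z) = Multiplicative.ofAdd 1 := by
  simp [expo, keep]

theorem expo_of_ne {x z : X} (h : x ≠ z) : expo Γ z (PresentedGroup.of x) = 1 := by
  simp [expo, keep, h]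

theorem expo_of_self_ne_one (z : X) : expo Γ z (PresentedGroup.of z) ≠ 1 := by
  rw [expo_of_self]; decide

theorem expo_eq_one_of_mem {A : Set X} {z : X} (hz : z ∉ A) {h : Grp Γ}
    (hh : h ∈ parabolic Γ A) : expo Γ z h = 1 := by
  have : parabolic Γ A ≤ (expo Γ z).ker :=
    (parabolic_le_iff Γ).2 fun x hx => expo_of_ne Γ fun e => hz (e ▸ hx)
  exact this hh

theorem subset_of_parabolic_le {A B : Set X} (h : parabolic Γ A ≤ parabolic Γ B) : A ⊆ B := by
  intro x hx
  by_contra hB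
  exact expo_of_self_ne_one Γ x (expo_eq_one_of_mem Γ hB (h (of_mem_parabolic Γ hx)))

theorem parabolic_injective : Function.Injective (parabolic Γ) := fun _ _ h =>
  (subset_of_parabolic_le Γ h.le).antisymm (subset_of_parabolic_le Γ h.ge)

/-- In the abelian group `G(Z)` on a clique `Z`, the `z`-part of an element can be split off. -/
theorem mul_zpow_mem_parabolic_diff {Z : Set X} (hZ : Z ⊆ orth Γ Z) {z : X} (hz : z ∈ Z)
    {h : Grp Γ} (hh : h ∈ parabolic Γ Z) :
    h * (PresentedGroup.of z) ^ (-(expo Γ z h).toAdd) ∈ parabolic Γ (Z \ {z}) := by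
  have hcomm : ∀ k ∈ parabolic Γ Z, Commute (PresentedGroup.of z : Grp Γ) k := fun k hk =>
    Subgroup.mem_centralizer_iff.1
      (parabolic_orth_le_centralizer Γ Z (parabolic_mono Γ hZ hk)) _ (of_mem_parabolic Γ hz)
  unfold parabolic at hh
  induction hh using Subgroup.closure_induction with
  | mem _ hx =>
    obtain ⟨x, hx, rfl⟩ := hx
    by_cases hxz : x = z
    · subst hxz
      simp [expo_of_self]
    · simpa [expo_of_ne Γ hxz] using of_mem_parabolic Γ (show x ∈ Z \ {z} from ⟨hx, hxz⟩)
  | one => simp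
  | mul a b ha hb iha ihb =>
    have hb' := (hcomm b hb).zpow_left (-(expo Γ z a).toAdd)
    have := mul_mem iha ihb
    -- Move the power of `z` that belongs to `a` past `b`, then collect the two powers.
    rwa [mul_assoc, ← mul_assoc _ b, hb'.eq, mul_assoc b, ← zpow_add, ← mul_assoc, ← neg_add,
      ← toAdd_mul, ← map_mul] at this
  | inv a ha iha =>
    have ha' := (hcomm a ha).zpow_left (-(expo Γ z a).toAdd)
    have := inv_mem iha
    rwa [← ha'.eq, mul_inv_rev, ← zpow_neg, ← toAdd_inv, ← toAdd_inv, inv_inv,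
      ← inv_inv (expo Γ z a), ← map_inv, toAdd_inv] at this

theorem mem_parabolic_of_expo_eq_one [Finite X] {Z S : Set X} (hZ : Z ⊆ orth Γ Z) {h : Grp Γ}
    (hh : h ∈ parabolic Γ Z) (hS : ∀ z ∉ S, expo Γ z h = 1) : h ∈ parabolic Γ S := by
  have key : h ∈ parabolic Γ (⋂ z ∈ Z \ S, Z \ {z}) :=
    mem_parabolic_biInter Γ (Set.toFinite _) _ fun z hz => by
      simpa [hS z hz.2] using mul_zpow_mem_parabolic_diff Γ hZ hz.1 hh
  refine parabolic_mono Γ ?_ (mem_parabolic_inter Γ hh key)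
  rintro x ⟨hxZ, hx⟩
  by_contra hxS
  exact (Set.mem_iInter₂.1 hx x ⟨hxZ, hxS⟩).2 rfl

end Expo

/-! ### Centralisers -/

section Centraliser

variable {X : Type*} (Γ : SimpleGraph X)

open Classical in
/-- The permutation of `G/G(z^⊥) × ℤ` attached to a vertex `x`: left translation by `x` on cosets,
and if `x = z`, moreover the integer goes up by one at the trivial coset. -/
noncomputable def countPerm (z x : X) :
    Equiv.Perm ((Grp Γ ⧸ parabolic Γ (orth Γ {z})) × ℤ) where
  toFun p := ((PresentedGroup.of x : Grp Γ) • p.1,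
    p.2 + if x = z ∧ p.1 = ((1 : Grp Γ) : Grp Γ ⧸ parabolic Γ (orth Γ {z})) then 1 else 0)
  invFun p := ((PresentedGroup.of x : Grp Γ)⁻¹ • p.1,
    p.2 - if x = z ∧ (PresentedGroup.of x : Grp Γ)⁻¹ • p.1 =
      ((1 : Grp Γ) : Grp Γ ⧸ parabolic Γ (orth Γ {z})) then 1 else 0)
  left_inv p := by simp
  right_inv p := by simp

theorem smul_coe_one_iff (z : X) {a : Grp Γ} (ha : a ∈ parabolic Γ (orth Γ {z}))
    (c : Grp Γ ⧸ parabolic Γ (orth Γ {z})) :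
    a • c = ((1 : Grp Γ) : Grp Γ ⧸ parabolic Γ (orth Γ {z})) ↔
      c = ((1 : Grp Γ) : Grp Γ ⧸ parabolic Γ (orth Γ {z})) := by
  have : a • ((1 : Grp Γ) : Grp Γ ⧸ parabolic Γ (orth Γ {z})) =
      ((1 : Grp Γ) : Grp Γ ⧸ parabolic Γ (orth Γ {z})) := by
    rw [← MulAction.mem_stabilizer_iff, MulAction.stabilizer_quotient]
    exact ha
  conv_lhs => rw [← this]
  exact smul_left_cancel_iff a

theorem commute_countPerm (z x y : X) (h : Γ.Adj x y) :
    Commute (countPerm Γ z x) (countPerm Γ z y) := by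
  -- A neighbour of `z` fixes the trivial coset, so it does not affect the count made by `z`.
  have hfix : ∀ {u}, Γ.Adj u z → (PresentedGroup.of u : Grp Γ) ∈ parabolic Γ (orth Γ {z}) :=
    fun {u} hu => of_mem_parabolic Γ (by simp [mem_orth_iff, hu])
  refine Equiv.ext fun p => Prod.ext ?_ ?_
  · simp only [countPerm, Equiv.Perm.mul_apply, Equiv.coe_fn_mk, smul_smul,
      (commute_of_adj Γ h).eq]
  · simp only [countPerm, Equiv.Perm.mul_apply, Equiv.coe_fn_mk]
    by_cases hx : x = z
    · subst hx
      have := smul_coe_one_iff Γ x (hfix h.symm) p.1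
      split_ifs <;> simp_all [h.ne']
    · by_cases hy : y = z
      · subst hy
        have := smul_coe_one_iff Γ y (hfix h) p.1
        split_ifs <;> simp_all
      · simp [hx, hy]

/-- The action of `G` on `G/G(z^⊥) × ℤ` in which `z` counts its passages through the trivial
coset. -/
noncomputable def countHom (z : X) :
    Grp Γ →* Equiv.Perm ((Grp Γ ⧸ parabolic Γ (orth Γ {z})) × ℤ) :=
  liftHom Γ (countPerm Γ z) (commute_countPerm Γ z)

/-- The action is by left translation on cosets, and commutes with translations of `ℤ`. -/
theorem exists_countHom_apply (z : X) (g : Grp Γ) :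
    ∃ d : Grp Γ ⧸ parabolic Γ (orth Γ {z}) → ℤ,
      ∀ c k, countHom Γ z g (c, k) = (g • c, k + d c) := by
  have hg : g ∈ Subgroup.closure (Set.range (PresentedGroup.of : X → Grp Γ)) := by
    rw [PresentedGroup.closure_range_of]; exact Subgroup.mem_top g
  induction hg using Subgroup.closure_induction with
  | mem _ hx =>
    obtain ⟨x, rfl⟩ := hx
    exact ⟨fun c => (countPerm Γ z x (c, 0)).2, fun c k => by simp [countHom, countPerm]⟩
  | one => exact ⟨fun _ => 0, fun c k => by simp⟩
  | mul a b _ _ iha ihb =>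
    obtain ⟨da, ha⟩ := iha
    obtain ⟨db, hb⟩ := ihb
    exact ⟨fun c => db c + da (b • c), fun c k => by
      rw [map_mul, Equiv.Perm.mul_apply, hb, ha, mul_smul, add_assoc]⟩
  | inv a _ iha =>
    obtain ⟨da, ha⟩ := iha
    exact ⟨fun c => -da (a⁻¹ • c), fun c k => by
      rw [map_inv, Equiv.Perm.inv_eq_iff_eq, ha]; simp⟩

open Classical in
/-- Elements of `G(z^⊥)` fix the trivial coset, so at that coset they count the exponent sum of
`z`, and elsewhere they count nothing. -/
theorem countHom_apply_of_mem (z : X) {h : Grp Γ} (hh : h ∈ parabolic Γ (orth Γ {z}))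
    (c : Grp Γ ⧸ parabolic Γ (orth Γ {z})) (k : ℤ) :
    countHom Γ z h (c, k) = (h • c, k + if c = ((1 : Grp Γ) : Grp Γ ⧸ parabolic Γ (orth Γ {z}))
      then (expo Γ z h).toAdd else 0) := by
  have hmem : ∀ a ∈ Subgroup.closure ((fun x : X => (PresentedGroup.of x : Grp Γ)) ''
      orth Γ {z}), a ∈ parabolic Γ (orth Γ {z}) := fun _ ha => ha
  unfold parabolic at hh
  induction hh using Subgroup.closure_induction generalizing c k with
  | mem _ hx =>
    obtain ⟨x, hx, rfl⟩ := hx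
    simp only [countHom, liftHom_of, countPerm, Equiv.coe_fn_mk]
    by_cases hxz : x = z
    · subst hxz
      simp [expo_of_self]
    · simp [hxz, expo_of_ne Γ hxz]
  | one => simp
  | mul a b _ hb iha ihb =>
    rw [map_mul, Equiv.Perm.mul_apply, ihb, iha, mul_smul]
    simp only [smul_coe_one_iff Γ z (hmem b hb), map_mul, toAdd_mul]
    split_ifs
    · rw [add_assoc, add_comm (expo Γ z b).toAdd]
    · simp
  | inv a ha iha =>
    rw [map_inv, Equiv.Perm.inv_eq_iff_eq, iha]
    simp only [smul_coe_one_iff Γ z (inv_mem (hmem a ha)), map_inv, toAdd_inv, smul_inv_smul]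
    split_ifs <;> simp

/-- An element that commutes with some `h ∈ G(z^⊥)` of non-zero exponent sum in `z` lies in
`G(z^⊥)`. -/
theorem mem_parabolic_orth_of_commute {z : X} {g h : Grp Γ}
    (hh : h ∈ parabolic Γ (orth Γ {z})) (hne : expo Γ z h ≠ 1) (hgh : Commute g h) :
    g ∈ parabolic Γ (orth Γ {z}) := by
  by_contra hg
  have hg1 : g • ((1 : Grp Γ) : Grp Γ ⧸ parabolic Γ (orth Γ {z})) ≠
      ((1 : Grp Γ) : Grp Γ ⧸ parabolic Γ (orth Γ {z})) := by
    rw [Ne, ← MulAction.mem_stabilizer_iff, MulAction.stabilizer_quotient]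
    exact hg
  obtain ⟨d, hd⟩ := exists_countHom_apply Γ z g
  -- Compare the integers in `gh · (1, 0)` and `hg · (1, 0)`.
  have key := DFunLike.congr_fun ((hgh.map (countHom Γ z)).eq)
    (((1 : Grp Γ) : Grp Γ ⧸ parabolic Γ (orth Γ {z})), (0 : ℤ))
  have key2 := congrArg Prod.snd key
  simp only [Equiv.Perm.mul_apply, hd, countHom_apply_of_mem Γ z hh, if_neg hg1, if_true] at key2
  rw [(smul_coe_one_iff Γ z hh _).2 rfl] at key2
  exact hne (Multiplicative.toAdd.injective (by rw [toAdd_one]; linarith))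

/-- If every `z ∈ S` has non-zero exponent sum in some element of `H ∩ G(z^⊥)`, then the
centraliser of `H` lies in `G(S^⊥)`. -/
theorem centralizer_le_parabolic_orth [Finite X] {H : Subgroup (Grp Γ)} {S : Set X}
    (hS : ∀ z ∈ S, ∃ h ∈ H, h ∈ parabolic Γ (orth Γ {z}) ∧ expo Γ z h ≠ 1) :
    Subgroup.centralizer (H : Set (Grp Γ)) ≤ parabolic Γ (orth Γ S) := by
  intro g hg
  rw [orth_eq_iInter]
  refine mem_parabolic_biInter Γ (Set.toFinite _) _ fun z hz => ?_
  obtain ⟨h, hH, hh, hne⟩ := hS z hz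
  exact mem_parabolic_orth_of_commute Γ hh hne (Subgroup.mem_centralizer_iff.1 hg h hH).symm

theorem centralizer_parabolic [Finite X] (A : Set X) :
    Subgroup.centralizer (parabolic Γ A : Set (Grp Γ)) = parabolic Γ (orth Γ A) :=
  le_antisymm
    (centralizer_le_parabolic_orth Γ fun z hz => ⟨_, of_mem_parabolic Γ hz,
      of_mem_parabolic Γ (self_mem_orth Γ z), expo_of_self_ne_one Γ z⟩)
    (parabolic_orth_le_centralizer Γ A)

/-- The support of a subgroup: the vertices with non-zero exponent sum in one of its elements. -/
def support (H : Subgroup (Grp Γ)) : Set X :=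
  {z | ∃ h ∈ H, expo Γ z h ≠ 1}

theorem support_subset {H : Subgroup (Grp Γ)} {Z : Set X} (hH : H ≤ parabolic Γ Z) :
    support Γ H ⊆ Z := by
  rintro z ⟨h, hh, hne⟩
  by_contra hz
  exact hne (expo_eq_one_of_mem Γ hz (hH hh))

theorem centralizer_centralizer_of_le_parabolic [Finite X] {Z : Set X} (hZ : Z ⊆ orth Γ Z)
    {H : Subgroup (Grp Γ)} (hH : H ≤ parabolic Γ Z) :
    Subgroup.centralizer (Subgroup.centralizer (H : Set (Grp Γ)) : Set (Grp Γ)) =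
      parabolic Γ (cl Γ (support Γ H)) := by
  have h1 : Subgroup.centralizer (H : Set (Grp Γ)) = parabolic Γ (orth Γ (support Γ H)) := by
    apply le_antisymm
    · refine centralizer_le_parabolic_orth Γ ?_
      rintro z ⟨h, hh, hne⟩
      have hz : z ∈ Z := support_subset Γ hH ⟨h, hh, hne⟩
      exact ⟨h, hh, parabolic_mono Γ
        (hZ.trans (orth_anti Γ (Set.singleton_subset_iff.2 hz))) (hH hh), hne⟩
    · rw [← centralizer_parabolic]
      refine Subgroup.centralizer_le fun h hh => ?_
      refine mem_parabolic_of_expo_eq_one Γ hZ (hH hh) fun z hz => ?_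
      by_contra hne
      exact hz ⟨h, hh, hne⟩
  rw [h1, centralizer_parabolic]
  rfl

theorem centralizer_centralizer_parabolic [Finite X] {Y : Set X} (hY : Y ∈ closedSets Γ) :
    Subgroup.centralizer (Subgroup.centralizer (parabolic Γ Y : Set (Grp Γ)) : Set (Grp Γ)) =
      parabolic Γ Y := by
  rw [centralizer_parabolic, centralizer_parabolic]
  exact congrArg _ (Eq.symm hY)

theorem map_centralizer_mulAut {G : Type*} [Group G] (φ : MulAut G) (H : Subgroup G) :
    (Subgroup.centralizer (H : Set G)).map φ.toMonoidHom =
      Subgroup.centralizer (H.map φ.toMonoidHom : Set G) := by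
  ext g
  simp only [Subgroup.mem_map, Subgroup.mem_centralizer_iff, Subgroup.coe_map,
    Set.forall_mem_image]
  constructor
  · rintro ⟨c, hc, rfl⟩ h hh
    rw [← map_mul, hc h hh, map_mul]
  · intro hg
    refine ⟨φ.symm g, fun h hh => φ.injective ?_, φ.apply_symm_apply g⟩
    rw [map_mul, map_mul, MulEquiv.apply_symm_apply]
    exact hg hh

end Centraliser

/-! ### The action on the closed sets below the maximal closures -/

section Action

variable {X : Type*} (Γ : SimpleGraph X)

/-- Holds because a closed set is the union of the closures of its vertices. -/
theorem parabolic_eq_iSup {Y : Set X} (hY : Y ∈ closedSets Γ) :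
    parabolic Γ Y = ⨆ y ∈ Y, parabolic Γ (cl Γ {y}) := by
  apply le_antisymm
  · exact (parabolic_le_iff Γ).2 fun y hy =>
      (le_iSup₂_of_le (f := fun y (_ : y ∈ Y) => parabolic Γ (cl Γ {y})) y hy le_rfl)
        (of_mem_parabolic Γ (subset_cl Γ _ rfl))
  · exact iSup₂_le fun y hy => parabolic_mono Γ
      (cl_subset_of_closed Γ hY (Set.singleton_subset_iff.2 hy))

variable [Finite X]

theorem exists_map_parabolic_eq {φ : MulAut (Grp Γ)} (hφ : φ ∈ StMax Γ) {Y Z : Set X}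
    (hY : Y ∈ closedSets Γ) (hZ : Z ∈ maxClosures Γ) (hYZ : Y ⊆ Z) :
    ∃ V ∈ closedSets Γ, V ⊆ Z ∧ (parabolic Γ Y).map φ.toMonoidHom = parabolic Γ V := by
  have hclique : Z ⊆ orth Γ Z := by
    obtain ⟨x, -, rfl⟩ := hZ
    exact cl_singleton_subset_orth Γ x
  have hle : (parabolic Γ Y).map φ.toMonoidHom ≤ parabolic Γ Z :=
    (Subgroup.map_mono (parabolic_mono Γ hYZ)).trans (hφ Z hZ).le
  refine ⟨cl Γ (support Γ ((parabolic Γ Y).map φ.toMonoidHom)), cl_mem_closedSets Γ _,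
    cl_subset_of_closed Γ (maxClosures_subset_closedSets Γ hZ) (support_subset Γ hle), ?_⟩
  rw [← centralizer_centralizer_of_le_parabolic Γ hclique hle, ← map_centralizer_mulAut,
    ← map_centralizer_mulAut, centralizer_centralizer_parabolic Γ hY]

theorem exists_closedBelowMax_map_eq (φ : StMax Γ) (Y : closedBelowMax Γ) :
    ∃ V : closedBelowMax Γ, (parabolic Γ (Y : Set X)).map (φ : MulAut (Grp Γ)).toMonoidHom =
      parabolic Γ (V : Set X) := by
  obtain ⟨Y, hY, Z, hZ, hYZ⟩ := Y
  obtain ⟨V, hV, hVZ, h⟩ := exists_map_parabolic_eq Γ φ.2 hY hZ hYZ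
  exact ⟨⟨V, hV, Z, hZ, hVZ⟩, h⟩

/-- The closed set `V` with `φ(G(Y)) = G(V)`. -/
noncomputable def image (φ : StMax Γ) (Y : closedBelowMax Γ) : closedBelowMax Γ :=
  (exists_closedBelowMax_map_eq Γ φ Y).choose

theorem image_eq_iff (φ : StMax Γ) (Y V : closedBelowMax Γ) :
    image Γ φ Y = V ↔ (parabolic Γ (Y : Set X)).map (φ : MulAut (Grp Γ)).toMonoidHom =
      parabolic Γ (V : Set X) := by
  have h : _ = parabolic Γ (image Γ φ Y : Set X) :=
    (exists_closedBelowMax_map_eq Γ φ Y).choose_spec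
  rw [h, (parabolic_injective Γ).eq_iff, Subtype.coe_inj]

/-- `St(L^max)` permutes the closed sets below `L^max` as it permutes their parabolic
subgroups. -/
noncomputable abbrev imageAction : MulAction (StMax Γ) (closedBelowMax Γ) where
  smul := image Γ
  one_smul Y := (image_eq_iff Γ 1 Y Y).2 (Subgroup.map_id _)
  mul_smul φ ψ Y := by
    refine (image_eq_iff Γ (φ * ψ) Y _).2 ?_
    have h : ((φ * ψ : StMax Γ) : MulAut (Grp Γ)).toMonoidHom =
      (φ : MulAut (Grp Γ)).toMonoidHom.comp (ψ : MulAut (Grp Γ)).toMonoidHom := rfl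
    rw [h, ← Subgroup.map_map, (image_eq_iff Γ ψ Y _).1 rfl]
    exact (image_eq_iff Γ φ _ _).1 rfl

/-- The permutation representation of `St(L^max)` on the closed sets below `L^max`. -/
noncomputable def permHom : StMax Γ →* Equiv.Perm (closedBelowMax Γ) :=
  letI := imageAction Γ
  MulAction.toPermHom _ _

theorem permHom_apply_eq_iff (φ : StMax Γ) (Y V : closedBelowMax Γ) :
    permHom Γ φ Y = V ↔ (parabolic Γ (Y : Set X)).map (φ : MulAut (Grp Γ)).toMonoidHom =
      parabolic Γ (V : Set X) :=
  image_eq_iff Γ φ Y V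

theorem permHom_apply_subset (φ : StMax Γ) (Y : closedBelowMax Γ) {Z : Set X}
    (hZ : Z ∈ maxClosures Γ) (hYZ : (Y : Set X) ⊆ Z) : (permHom Γ φ Y : Set X) ⊆ Z := by
  refine subset_of_parabolic_le Γ ?_
  rw [← (permHom_apply_eq_iff Γ φ Y _).1 rfl, ← φ.2 Z hZ]
  exact Subgroup.map_mono (parabolic_mono Γ hYZ)

theorem ker_permHom_le : (permHom Γ).ker ≤ (St Γ).subgroupOf (StMax Γ) := by
  intro φ hφ Y hY
  have h : ∀ y, (parabolic Γ (cl Γ {y})).map (φ : MulAut (Grp Γ)).toMonoidHom =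
      parabolic Γ (cl Γ {y}) := fun y => by
    let C : closedBelowMax Γ := ⟨cl Γ {y}, cl_singleton_mem_closedBelowMax Γ y⟩
    have hC : permHom Γ φ C = C := by rw [MonoidHom.mem_ker.1 hφ, Equiv.Perm.one_apply]
    exact (permHom_apply_eq_iff Γ φ C C).1 hC
  change (parabolic Γ Y).map (φ : MulAut (Grp Γ)).toMonoidHom = _
  rw [parabolic_eq_iSup Γ hY, Subgroup.map_iSup]
  refine iSup_congr fun y => ?_
  rw [Subgroup.map_iSup]
  exact iSup_congr fun _ => h y

end Action

end PCGroup

theorem mainTheorem4 {X : Type*} [Finite X] (Γ : SimpleGraph X) :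
    Subgroup.Commensurable (PCGroup.St Γ) (PCGroup.StMax Γ) ∧
    PCGroup.St Γ ≤ PCGroup.StMax Γ ∧
    ((PCGroup.St Γ).subgroupOf (PCGroup.StMax Γ)).FiniteIndex ∧
    (PCGroup.closedBelowMax Γ).Finite ∧
    ∃ σ : PCGroup.StMax Γ →* Equiv.Perm (PCGroup.closedBelowMax Γ),
      (∀ (φ : PCGroup.StMax Γ) (Y V : PCGroup.closedBelowMax Γ),
        σ φ Y = V ↔
          (PCGroup.parabolic Γ (Y : Set X)).map (φ : MulAut (PCGroup.Grp Γ)).toMonoidHom =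
            PCGroup.parabolic Γ (V : Set X)) ∧
      (∀ (φ : PCGroup.StMax Γ) (Y : PCGroup.closedBelowMax Γ),
        ∀ Z ∈ PCGroup.maxClosures Γ, (Y : Set X) ⊆ Z → (σ φ Y : Set X) ⊆ Z) ∧
      σ.ker ≤ (PCGroup.St Γ).subgroupOf (PCGroup.StMax Γ) := by
  have hle : PCGroup.St Γ ≤ PCGroup.StMax Γ := fun φ hφ Y hY =>
    hφ Y (PCGroup.maxClosures_subset_closedSets Γ hY)
  have hfin : ((PCGroup.St Γ).subgroupOf (PCGroup.StMax Γ)).FiniteIndex :=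
    Subgroup.finiteIndex_of_le (PCGroup.ker_permHom_le Γ)
  refine ⟨⟨hfin.index_ne_zero, ?_⟩, hle, hfin, Set.toFinite _, PCGroup.permHom Γ,
    PCGroup.permHom_apply_eq_iff Γ,
    fun φ Y Z hZ hYZ => PCGroup.permHom_apply_subset Γ φ Y hZ hYZ, PCGroup.ker_permHom_le Γ⟩
  rw [Subgroup.relIndex_eq_one.2 hle]
  exact one_ne_zero
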